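/- A Boolean function is a function $f\colon\{0,1\}^n\to\{0,1\}$ with $n\ge 1$. Its rational degree $\mathrm{rdeg}(f)$ is the minimum of $\max(\deg p,\deg q)$ over all pairs of real multilinear polynomials $p,q\in\mathbb R[X_1,\dots,X_n]$ such that $q(x)\ne 0$ and $p(x)/q(x)=f(x)$ for all $x\in\{0,1\}^n$. A $T$-query postselected quantum algorithm acts on finitely many qubits, with basis states $|a\rangle|b\rangle|i\rangle|t\rangle|z\rangle$, where $a,b,t$ are single qubits, $i$ is an index register of $\lceil\log_2 n\rceil$ qubits, and $z$ is an arbitrary number of work qubits. On input $x\in\{0,1\}^n$ it prepares the state $U_T O_x U_{T-1} O_x\cdots O_x U_0|0\cdots 0\rangle$, where the unitaries $U_0,\dots,U_T$ do not depend on $x$ and $O_x|a,b,i,t,z\rangle=|a,b,i,t\oplus x_i,z\rangle$ (with $O_x$ acting as the identity on those $i$ that are not the address of an input bit). It then measures the first two qubits: $a$ is the postselection bit and $b$ the output bit. The algorithm computes $f$ with error at most $\epsilon$ if for every $x\in\{0,1\}^n$ we have $\Pr[a=1]>0$ and $\Pr[b=f(x)\mid a=1]\ge 1-\epsilon$. Let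 $\mathrm{PostQ}_\epsilon(f)$ be the minimum $T$ for which such an algorithm with $T$ queries exists. Then for every Boolean function $f$, both minima $\mathrm{rdeg}(f)$ and $\mathrm{PostQ}_0(f)$ exist (that is, they are taken over nonempty sets), and $$\mathrm{rdeg}(f)=\mathrm{PostQ}_0(f).$$ -/

import Mathlib

/-- A bit, as a real number. -/
def bitVal (b : Bool) : ℝ := if b then 1 else 0

/-- `p / q` is a rational representation of `f`: `p`, `q` are multilinear real polynomials,
`q` has no zero on the cube, and `p / q = f` on the cube. -/
def IsRationalRep {n : ℕ} (f : (Fin n → Bool) → Bool) (p q : MvPolynomial (Fin n) ℝ) : Prop :=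
  p ∈ MvPolynomial.restrictDegree (Fin n) ℝ 1 ∧
  q ∈ MvPolynomial.restrictDegree (Fin n) ℝ 1 ∧
  ∀ x : Fin n → Bool,
    MvPolynomial.eval (fun i => bitVal (x i)) q ≠ 0 ∧
    MvPolynomial.eval (fun i => bitVal (x i)) p / MvPolynomial.eval (fun i => bitVal (x i)) q
      = bitVal (f x)

/-- The degrees `max (deg p) (deg q)` of the rational representations `p / q` of `f`. -/
def rationalRepDegrees {n : ℕ} (f : (Fin n → Bool) → Bool) : Set ℕ :=
  {d | ∃ p q : MvPolynomial (Fin n) ℝ,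
    IsRationalRep f p q ∧ d = max p.totalDegree q.totalDegree}

/-- The rational degree of `f`. -/
noncomputable def rdeg {n : ℕ} (f : (Fin n → Bool) → Bool) : ℕ :=
  sInf (rationalRepDegrees f)

/-- Computational basis states of the qubits of a query algorithm on `n`-bit inputs.
In order: the postselection qubit, the output qubit, the `⌈log₂ n⌉` qubits of the index
register, the target qubit of the query, and `w` further work qubits. -/
abbrev QBasis (n w : ℕ) : Type :=
  Bool × Bool × (Fin (Nat.clog 2 n) → Bool) × Bool × (Fin w → Bool)

/-- The bit of `x` at address `j`; addresses outside the input read `false`, so that a query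
at such an address acts as the identity. -/
def bitAt {n : ℕ} (x : Fin n → Bool) (j : ℕ) : Bool :=
  if h : j < n then x ⟨j, h⟩ else false

/-- The action of a query on basis states: `|a, b, i, t, z⟩ ↦ |a, b, i, t ⊕ xᵢ, z⟩`. -/
def queryBasis {n w : ℕ} (x : Fin n → Bool) (s : QBasis n w) : QBasis n w :=
  (s.1, s.2.1, s.2.2.1, xor s.2.2.2.1 (bitAt x (Nat.ofBits s.2.2.1)), s.2.2.2.2)

/-- The query operator `O_x`, as a matrix: it sends `|s⟩` to `|queryBasis x s⟩`. -/
def oracle {n : ℕ} (w : ℕ) (x : Fin n → Bool) : Matrix (QBasis n w) (QBasis n w) ℂ :=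
  Matrix.of fun s s' => if s = queryBasis x s' then 1 else 0

/-- The all-zero basis state `|0…0⟩`. -/
def zeroBasis (n w : ℕ) : QBasis n w :=
  (false, false, fun _ => false, false, fun _ => false)

/-- A postselected quantum query algorithm on `n`-bit inputs: a number of work qubits, a number
of queries `T`, and input-independent unitaries. Only `U 0, …, U T` are ever applied. -/
structure PostselAlg (n : ℕ) where
  work : ℕ
  queries : ℕ
  U : ℕ → Matrix.unitaryGroup (QBasis n work) ℂ

namespace PostselAlg

variable {n : ℕ}

/-- The state `U_t O_x U_{t-1} O_x ⋯ O_x U_0 |0…0⟩`, which uses `t` queries. -/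
noncomputable def stateAfter (A : PostselAlg n) (x : Fin n → Bool) : ℕ → QBasis n A.work → ℂ
  | 0 => Matrix.mulVec (A.U 0 : Matrix (QBasis n A.work) (QBasis n A.work) ℂ)
      (Pi.single (zeroBasis n A.work) 1)
  | t + 1 => Matrix.mulVec (A.U (t + 1) : Matrix (QBasis n A.work) (QBasis n A.work) ℂ)
      (Matrix.mulVec (oracle A.work x) (A.stateAfter x t))

/-- The state of the algorithm on input `x` just before postselection. -/
noncomputable def finalState (A : PostselAlg n) (x : Fin n → Bool) : QBasis n A.work → ℂ :=
  A.stateAfter x A.queries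

/-- The probability that measuring the first two qubits of the final state
gives `1` (postselection succeeds) and `b`. -/
noncomputable def jointProb (A : PostselAlg n) (x : Fin n → Bool) (b : Bool) : ℝ :=
  ∑ s : QBasis n A.work, if s.1 = true ∧ s.2.1 = b then ‖A.finalState x s‖ ^ 2 else 0

/-- The probability that the postselection qubit of the final state is measured as `1`. -/
noncomputable def postProb (A : PostselAlg n) (x : Fin n → Bool) : ℝ :=
  ∑ s : QBasis n A.work, if s.1 = true then ‖A.finalState x s‖ ^ 2 else 0

/-- `A` computes `f` with error at most `ε`: on every input, postselection succeeds with positive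
probability and, conditioned on that, the output is `f x` with probability at least `1 - ε`. -/
def Computes (A : PostselAlg n) (ε : ℝ) (f : (Fin n → Bool) → Bool) : Prop :=
  ∀ x : Fin n → Bool, 0 < A.postProb x ∧ 1 - ε ≤ A.jointProb x (f x) / A.postProb x

end PostselAlg

/-- The numbers of queries of the postselected algorithms computing `f` with error at most `ε`. -/
def postQueryCounts {n : ℕ} (ε : ℝ) (f : (Fin n → Bool) → Bool) : Set ℕ :=
  {T | ∃ A : PostselAlg n, A.Computes ε f ∧ T = A.queries}

/-- The `ε`-error postselected quantum query complexity of `f`. -/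
noncomputable def PostQ {n : ℕ} (ε : ℝ) (f : (Fin n → Bool) → Bool) : ℕ :=
  sInf (postQueryCounts ε f)

/-!
The amplitudes of the initial state are constant and each query multiplies them by affine
functions of the input bits, so after `T` queries every real-linear functional of the state is a
polynomial of degree at most `T`. The unnormalized postselected states are finitely many nonzero
vectors, so some functional vanishes on none of them: its value is the denominator of a rational
representation, and its value on the part with output bit `1` is the numerator.

Conversely, the polynomials of degree at most `d` on the cube are spanned by the products of `d`
phases `(-1) ^ xᵢ` and `1`. Each such product is the eigenvalue collected by a computational path
that makes the corresponding queries with `|-⟩` in the target qubit. Running all paths in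
superposition, with the coefficients of `p` and `q - p` on the paths with output bit `1` and `0`,
and giving all paths a common component in the postselected space, one obtains postselected
amplitudes proportional to `p x` and `q x - p x`; the one for the wrong output is zero.
-/

section CubePolynomials

variable {ι : Type*} {d e : ℕ}

/-- The coordinate function `xᵢ` on the cube. -/
def cubeCoord (i : ι) (x : ι → Bool) : ℝ := bitVal (x i)

/-- The real functions on the cube that are polynomials of degree at most `d` in the coordinates,
encoded as the `d`-th power of the submodule of affine functions. -/
def cubePoly (ι : Type*) (d : ℕ) : Submodule ℝ ((ι → Bool) → ℝ) :=
  Submodule.span ℝ (insert 1 (Set.range cubeCoord)) ^ d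

theorem one_mem_cubePoly : 1 ∈ cubePoly ι d :=
  one_pow (M := (ι → Bool) → ℝ) d ▸
    Submodule.pow_mem_pow _ (Submodule.subset_span (Set.mem_insert 1 _)) d

theorem cubeCoord_mem_cubePoly_one (i : ι) : cubeCoord i ∈ cubePoly ι 1 := by
  rw [cubePoly, pow_one]
  exact Submodule.subset_span (Set.mem_insert_of_mem 1 ⟨i, rfl⟩)

theorem const_mem_cubePoly (c : ℝ) : (fun _ => c) ∈ cubePoly ι d := by
  simpa [funext_iff, Pi.smul_def] using Submodule.smul_mem _ c (one_mem_cubePoly (ι := ι) (d := d))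

theorem mul_mem_cubePoly_add {F G : (ι → Bool) → ℝ} (hF : F ∈ cubePoly ι d)
    (hG : G ∈ cubePoly ι e) : F * G ∈ cubePoly ι (d + e) := by
  rw [cubePoly, pow_add]
  exact Submodule.mul_mem_mul hF hG

theorem cubePoly_mono (h : d ≤ e) : cubePoly ι d ≤ cubePoly ι e := fun F hF => by
  simpa [Nat.add_sub_cancel' h] using
    mul_mem_cubePoly_add hF (one_mem_cubePoly (ι := ι) (d := e - d))

theorem prod_mem_cubePoly_sum {κ : Type*} {s : Finset κ} {F : κ → (ι → Bool) → ℝ} {d : κ → ℕ}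
    (hF : ∀ k ∈ s, F k ∈ cubePoly ι (d k)) : ∏ k ∈ s, F k ∈ cubePoly ι (∑ k ∈ s, d k) := by
  classical
  induction s using Finset.induction_on with
  | empty => exact one_mem_cubePoly
  | insert k s hk ih =>
    rw [Finset.prod_insert hk, Finset.sum_insert hk]
    exact mul_mem_cubePoly_add (hF k (Finset.mem_insert_self k s))
      (ih fun j hj => hF j (Finset.mem_insert_of_mem hj))

theorem pow_mem_cubePoly_mul {F : (ι → Bool) → ℝ} (hF : F ∈ cubePoly ι d) (k : ℕ) :
    F ^ k ∈ cubePoly ι (d * k) := by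
  rw [cubePoly, pow_mul]
  exact Submodule.pow_mem_pow _ hF k

theorem eval_mem_cubePoly (p : MvPolynomial ι ℝ) :
    (fun x => MvPolynomial.eval (fun i => bitVal (x i)) p) ∈ cubePoly ι p.totalDegree := by
  have hsum : (fun x => MvPolynomial.eval (fun i => bitVal (x i)) p) =
      ∑ m ∈ p.support, p.coeff m • ∏ i ∈ m.support, cubeCoord i ^ m i := by
    ext x
    simp [MvPolynomial.eval_eq, cubeCoord]
  rw [hsum]
  refine Submodule.sum_mem _ fun m hm => Submodule.smul_mem _ _ ?_
  refine cubePoly_mono (MvPolynomial.le_totalDegree hm) (prod_mem_cubePoly_sum fun i _ => ?_)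
  simpa using pow_mem_cubePoly_mul (cubeCoord_mem_cubePoly_one i) (m i)

theorem mem_cubePoly_card [Fintype ι] (F : (ι → Bool) → ℝ) : F ∈ cubePoly ι (Fintype.card ι) := by
  classical
  let literal (y : ι → Bool) (i : ι) : (ι → Bool) → ℝ :=
    if y i then cubeCoord i else 1 - cubeCoord i
  have hliteral (y : ι → Bool) (i : ι) : literal y i ∈ cubePoly ι 1 := by
    dsimp only [literal]
    split_ifs
    · exact cubeCoord_mem_cubePoly_one i
    · exact Submodule.sub_mem _ one_mem_cubePoly (cubeCoord_mem_cubePoly_one i)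
  have literal_apply (x y : ι → Bool) (i : ι) : literal y i x = if y i = x i then 1 else 0 := by
    cases hy : y i <;> cases hx : x i <;> simp [literal, cubeCoord, bitVal, hx, hy]
  have hF : F = ∑ y, F y • ∏ i, literal y i := by
    ext x
    simp [Finset.prod_apply, literal_apply, Finset.prod_ite_zero, ← funext_iff]
  rw [hF]
  refine Submodule.sum_mem _ fun y _ => Submodule.smul_mem _ _ ?_
  simpa using prod_mem_cubePoly_sum (s := Finset.univ) fun i _ => hliteral y i

theorem cubeCoord_mul_self (i : ι) : cubeCoord i * cubeCoord i = cubeCoord i := by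
  ext x
  cases hx : x i <;> simp [cubeCoord, bitVal, hx]

theorem cubeCoord_mul_prod [DecidableEq ι] (i : ι) (S : Finset ι) :
    cubeCoord i * ∏ j ∈ S, cubeCoord j = ∏ j ∈ insert i S, cubeCoord j := by
  by_cases hi : i ∈ S
  · rw [Finset.insert_eq_of_mem hi, ← Finset.mul_prod_erase S _ hi, ← mul_assoc,
      cubeCoord_mul_self]
  · rw [Finset.prod_insert hi]

theorem cubePoly_le_span_prod_cubeCoord (ι : Type*) (d : ℕ) :
    cubePoly ι d ≤ Submodule.span ℝ ((fun S => ∏ i ∈ S, cubeCoord i) '' {S | S.card ≤ d}) := by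
  classical
  induction d with
  | zero =>
    rw [cubePoly, pow_zero, Submodule.one_le]
    exact Submodule.subset_span ⟨∅, by simp⟩
  | succ d ih =>
    rw [cubePoly, pow_succ']
    refine (mul_le_mul_right ih _).trans ?_
    rw [Submodule.span_mul_span]
    refine Submodule.span_mono ?_
    rintro _ ⟨_, rfl | ⟨i, rfl⟩, _, ⟨S, hS, rfl⟩, rfl⟩
    · exact ⟨S, Nat.le_succ_of_le hS, (one_mul _).symm⟩
    · exact ⟨insert i S, (Finset.card_insert_le i S).trans (Nat.succ_le_succ hS),
        (cubeCoord_mul_prod i S).symm⟩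

theorem prod_X_mem_restrictDegree_one {R : Type*} [CommSemiring R] (S : Finset ι) :
    ∏ i ∈ S, MvPolynomial.X i ∈ MvPolynomial.restrictDegree ι R 1 := by
  classical
  have hdegrees : (∏ i ∈ S, MvPolynomial.X i : MvPolynomial ι R).degrees ≤ S.val :=
    MvPolynomial.degrees_prod_le.trans <|
      (Finset.sum_le_sum fun i _ => MvPolynomial.degrees_X' i).trans_eq
        (Finset.sum_multiset_singleton S)
  rw [MvPolynomial.mem_restrictDegree_iff_sup]
  exact fun i => Multiset.nodup_iff_count_le_one.mp (Multiset.nodup_of_le hdegrees S.nodup) i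

theorem exists_multilinear_eval_eq {F : (ι → Bool) → ℝ} (hF : F ∈ cubePoly ι d) :
    ∃ p ∈ MvPolynomial.restrictDegree ι ℝ 1, p.totalDegree ≤ d ∧
      ∀ x : ι → Bool, MvPolynomial.eval (fun i => bitVal (x i)) p = F x := by
  replace hF := cubePoly_le_span_prod_cubeCoord ι d hF
  induction hF using Submodule.span_induction with
  | mem F hF =>
    obtain ⟨S, hS, rfl⟩ := hF
    refine ⟨∏ i ∈ S, MvPolynomial.X i, prod_X_mem_restrictDegree_one S,
      (MvPolynomial.totalDegree_finsetProd _ _).trans (by simpa using hS), fun x => ?_⟩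
    simp [cubeCoord]
  | zero => exact ⟨0, Submodule.zero_mem _, by simp, by simp⟩
  | add F G _ _ hF hG =>
    obtain ⟨p, hp, hpd, hpF⟩ := hF
    obtain ⟨q, hq, hqd, hqG⟩ := hG
    exact ⟨p + q, Submodule.add_mem _ hp hq,
      (MvPolynomial.totalDegree_add p q).trans (max_le hpd hqd), by simp [hpF, hqG]⟩
  | smul a F _ hF =>
    obtain ⟨p, hp, hpd, hpF⟩ := hF
    exact ⟨a • p, Submodule.smul_mem _ a hp, (MvPolynomial.totalDegree_smul_le a p).trans hpd,
      by simp [MvPolynomial.smul_eval, hpF]⟩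

/-- The phase `(-1) ^ xᵢ` picked up by a query at `i` with `|-⟩` in the target register;
`none` stands for making no use of the query, with phase `1`. -/
def queryPhase (o : Option ι) : (ι → Bool) → ℝ :=
  o.elim 1 fun i => 1 - (2 : ℝ) • cubeCoord i

theorem span_range_queryPhase (ι : Type*) :
    Submodule.span ℝ (Set.range queryPhase) =
      Submodule.span ℝ (insert (1 : (ι → Bool) → ℝ) (Set.range cubeCoord)) := by
  apply le_antisymm <;> refine Submodule.span_le.mpr ?_
  · have hone : (1 : (ι → Bool) → ℝ) ∈
        Submodule.span ℝ (insert (1 : (ι → Bool) → ℝ) (Set.range cubeCoord)) :=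
      Submodule.subset_span (Set.mem_insert 1 _)
    rintro _ ⟨_ | i, rfl⟩
    · exact hone
    · exact Submodule.sub_mem _ hone
        (Submodule.smul_mem _ _ (Submodule.subset_span (Set.mem_insert_of_mem 1 ⟨i, rfl⟩)))
  · have hphase (o : Option ι) : queryPhase o ∈ Submodule.span ℝ (Set.range queryPhase) :=
      Submodule.subset_span ⟨o, rfl⟩
    rintro _ (rfl | ⟨i, rfl⟩)
    · exact hphase none
    · have hcoord : cubeCoord i = (2⁻¹ : ℝ) • (queryPhase none - queryPhase (some i)) := by
        simp [queryPhase]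
      rw [hcoord]
      exact Submodule.smul_mem _ _ (Submodule.sub_mem _ (hphase none) (hphase (some i)))

theorem cubePoly_eq_span_prod_queryPhase (ι : Type*) (d : ℕ) :
    cubePoly ι d =
      Submodule.span ℝ (Set.range fun l : Fin d → Option ι => ∏ k, queryPhase (l k)) := by
  rw [cubePoly, ← span_range_queryPhase, Submodule.span_pow]
  congr 1
  ext F
  simp only [Set.mem_pow, List.prod_ofFn, Set.mem_range]
  constructor
  · rintro ⟨g, rfl⟩
    choose l hl using fun k => (g k).2
    exact ⟨l, by simp only [hl]⟩
  · rintro ⟨l, rfl⟩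
    exact ⟨fun k => ⟨queryPhase (l k), l k, rfl⟩, rfl⟩

end CubePolynomials

section RationalDegree

variable {ι : Type*} {n d : ℕ}

/-- On the cube, `f` is a quotient of two polynomials of degree at most `d` whose denominator has
no zero; the quotient is cleared of its denominator. -/
def HasRationalDegreeLE (f : (ι → Bool) → Bool) (d : ℕ) : Prop :=
  ∃ P ∈ cubePoly ι d, ∃ Q ∈ cubePoly ι d, ∀ x, Q x ≠ 0 ∧ P x = bitVal (f x) * Q x

theorem hasRationalDegreeLE_card [Fintype ι] (f : (ι → Bool) → Bool) :
    HasRationalDegreeLE f (Fintype.card ι) :=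
  ⟨fun x => bitVal (f x), mem_cubePoly_card _, 1, one_mem_cubePoly,
    fun _ => ⟨one_ne_zero, (mul_one _).symm⟩⟩

theorem hasRationalDegreeLE_iff_mem_upperClosure {f : (Fin n → Bool) → Bool} :
    HasRationalDegreeLE f d ↔ d ∈ upperClosure (rationalRepDegrees f) := by
  rw [mem_upperClosure]
  constructor
  · rintro ⟨P, hP, Q, hQ, hPQ⟩
    obtain ⟨p, hp, hpd, hpP⟩ := exists_multilinear_eval_eq hP
    obtain ⟨q, hq, hqd, hqQ⟩ := exists_multilinear_eval_eq hQ
    refine ⟨_, ⟨p, q, ⟨hp, hq, fun x => ?_⟩, rfl⟩, max_le hpd hqd⟩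
    obtain ⟨hQx, hPx⟩ := hPQ x
    rw [hpP, hqQ]
    exact ⟨hQx, (div_eq_iff hQx).mpr hPx⟩
  · rintro ⟨_, ⟨p, q, ⟨-, -, hpq⟩, rfl⟩, hd⟩
    obtain ⟨hpd, hqd⟩ := max_le_iff.mp hd
    exact ⟨_, cubePoly_mono hpd (eval_mem_cubePoly p), _, cubePoly_mono hqd (eval_mem_cubePoly q),
      fun x => ⟨(hpq x).1, (div_eq_iff (hpq x).1).mp (hpq x).2⟩⟩

end RationalDegree

section Orthonormal

variable {𝕜 E ι κ : Type*} [RCLike 𝕜] [NormedAddCommGroup E] [InnerProductSpace 𝕜 E]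

theorem exists_linearIsometryEquiv_apply_eq_of_orthonormal [FiniteDimensional 𝕜 E] {u v : ι → E}
    (hu : Orthonormal 𝕜 u) (hv : Orthonormal 𝕜 v) : ∃ T : E ≃ₗᵢ[𝕜] E, ∀ i, T (u i) = v i := by
  let b := Module.Basis.span hu.linearIndependent
  have hbu : ⇑b = fun i => ⟨u i, Submodule.subset_span ⟨i, rfl⟩⟩ :=
    funext fun i => Module.Basis.span_apply hu.linearIndependent i
  have hbv : b.constr 𝕜 v ∘ b = v := funext fun i => b.constr_basis 𝕜 v i
  let L := (b.constr 𝕜 v).isometryOfOrthonormal (hbu ▸ orthonormal_span hu) (hbv.symm ▸ hv)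
  refine ⟨L.extend.toLinearIsometryEquiv rfl, fun i => ?_⟩
  calc L.extend (u i) = L.extend (b i) := by rw [hbu]
    _ = L (b i) := L.extend_apply (b i)
    _ = v i := congrFun hbv i

theorem exists_unitaryGroup_mulVec_eq_of_orthonormal {B : Type*} [Fintype B] [DecidableEq B]
    {u v : ι → EuclideanSpace 𝕜 B} (hu : Orthonormal 𝕜 u) (hv : Orthonormal 𝕜 v) :
    ∃ W : Matrix.unitaryGroup B 𝕜, ∀ i, Matrix.mulVec (W : Matrix B B 𝕜) (u i) = v i := by
  obtain ⟨T, hT⟩ := exists_linearIsometryEquiv_apply_eq_of_orthonormal hu hv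
  let S := Unitary.linearIsometryEquiv.symm T
  refine ⟨⟨(Matrix.toEuclideanCLM (𝕜 := 𝕜) (n := B)).symm S, Unitary.map_mem _ S.2⟩, fun i => ?_⟩
  rw [← Matrix.ofLp_toEuclideanCLM, ← hT, StarAlgEquiv.apply_symm_apply]
  rfl

theorem exists_unitaryGroup_mulVec_single_eq_smul {B : Type*} [Fintype B] [DecidableEq B]
    {y : EuclideanSpace 𝕜 B} (hy : y ≠ 0) (s : B) :
    ∃ W : Matrix.unitaryGroup B 𝕜, ∃ c : 𝕜, c ≠ 0 ∧
      (W : Matrix B B 𝕜).mulVec (Pi.single s 1) = c • ⇑y := by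
  have hs : Orthonormal 𝕜 fun _ : Unit => EuclideanSpace.single s (1 : 𝕜) :=
    EuclideanSpace.orthonormal_single.comp _ (Function.injective_of_subsingleton _)
  have hy' : Orthonormal 𝕜 fun _ : Unit => (‖y‖⁻¹ : 𝕜) • y :=
    ⟨fun _ => norm_smul_inv_norm hy, fun i j hij => (hij (Subsingleton.elim i j)).elim⟩
  obtain ⟨W, hW⟩ := exists_unitaryGroup_mulVec_eq_of_orthonormal hs hy'
  exact ⟨W, (‖y‖⁻¹ : 𝕜), by simpa using hy, by simpa using hW ()⟩

theorem orthonormal_sum_smul [Fintype κ] {u : ι × κ → E} (hu : Orthonormal 𝕜 u) {c : ι → κ → 𝕜}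
    (hc : ∀ i, ∑ k, ‖c i k‖ ^ 2 = 1) : Orthonormal 𝕜 fun i => ∑ k, c i k • u (i, k) := by
  classical
  rw [orthonormal_iff_ite] at hu ⊢
  intro i j
  simp only [sum_inner, inner_sum, inner_smul_left, inner_smul_right, hu, Prod.mk.injEq]
  rcases eq_or_ne i j with rfl | hij
  · simpa [RCLike.mul_conj] using congrArg (RCLike.ofReal (K := 𝕜)) (hc i)
  · simp [hij]

theorem orthonormal_add_smul_sub_smul_sum [Fintype ι] {u : ι × κ → E} {e : κ → E}
    (hu : Orthonormal 𝕜 u) (he : Orthonormal 𝕜 e) (hue : ∀ i k, inner 𝕜 (u i) (e k) = 0)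
    {r : 𝕜} (hr : Fintype.card ι * ‖r‖ ^ 2 = 1) :
    Orthonormal 𝕜 fun i : ι × κ => u i + r • e i.2 - (‖r‖ ^ 2 : 𝕜) • ∑ j, u (j, i.2) := by
  classical
  have heu (k : κ) (i : ι × κ) : inner 𝕜 (e k) (u i) = 0 := inner_eq_zero_symm.mp (hue i k)
  have hr' : (Fintype.card ι : 𝕜) * (‖r‖ : 𝕜) ^ 2 = 1 := by exact_mod_cast hr
  have hconj : r * starRingEnd 𝕜 r = (‖r‖ : 𝕜) ^ 2 := RCLike.mul_conj r
  rw [orthonormal_iff_ite] at hu he ⊢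
  rintro ⟨i, k⟩ ⟨j, l⟩
  simp only [inner_add_left, inner_add_right, inner_sub_left, inner_sub_right, inner_smul_left,
    inner_smul_right, sum_inner, inner_sum, hu, he, hue, heu, Prod.mk.injEq]
  rcases eq_or_ne k l with rfl | hkl
  · simp only [and_true, mul_zero, add_zero, map_pow, RCLike.conj_ofReal, Finset.sum_ite_eq',
      Finset.mem_univ, if_true, mul_one, zero_add, Finset.sum_const_zero, sub_zero,
      Finset.sum_sub_distrib, Finset.sum_ite_eq, Finset.sum_const, Finset.card_univ, nsmul_eq_mul]
    linear_combination hconj + (‖r‖ : 𝕜) ^ 2 * hr'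
  · simp [hkl]

end Orthonormal

section Oracle

variable {n w : ℕ}

theorem queryBasis_involutive (x : Fin n → Bool) : Function.Involutive (queryBasis (w := w) x) := by
  rintro ⟨a, b, i, t, z⟩
  simp [queryBasis]

theorem oracle_mulVec_apply (x : Fin n → Bool) (v : QBasis n w → ℂ) (s : QBasis n w) :
    (oracle w x).mulVec v s = v (queryBasis x s) := by
  simp [Matrix.mulVec, dotProduct, oracle, ← (queryBasis_involutive x).eq_iff]

theorem bitVal_bitAt_mem_cubePoly_one (j : ℕ) :
    (fun x : Fin n → Bool => bitVal (bitAt x j)) ∈ cubePoly (Fin n) 1 := by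
  by_cases hj : j < n
  · simp only [bitAt, hj, dite_true]
    exact cubeCoord_mem_cubePoly_one (⟨j, hj⟩ : Fin n)
  · simpa [bitAt, hj, bitVal] using const_mem_cubePoly (ι := Fin n) (d := 1) 0

theorem apply_queryBasis (x : Fin n → Bool) (v : QBasis n w → ℂ) (a b : Bool)
    (i : Fin (Nat.clog 2 n) → Bool) (t : Bool) (z : Fin w → Bool) :
    v (queryBasis x (a, b, i, t, z)) = v (a, b, i, t, z) +
      bitVal (bitAt x (Nat.ofBits i)) • (v (a, b, i, !t, z) - v (a, b, i, t, z)) := by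
  cases h : bitAt x (Nat.ofBits i) <;> simp [queryBasis, bitVal, h]

end Oracle

namespace PostselAlg

variable {n : ℕ}

theorem linear_stateAfter_mem_cubePoly (A : PostselAlg n) (t : ℕ)
    (φ : (QBasis n A.work → ℂ) →ₗ[ℝ] ℝ) :
    (fun x => φ (A.stateAfter x t)) ∈ cubePoly (Fin n) t := by
  induction t generalizing φ with
  | zero => simpa only [stateAfter] using const_mem_cubePoly _
  | succ t ih =>
    let U : Matrix (QBasis n A.work) (QBasis n A.work) ℂ := A.U (t + 1)
    let ψ (s : QBasis n A.work) : ℂ →ₗ[ℝ] ℝ :=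
      φ ∘ₗ U.mulVecLin.restrictScalars ℝ ∘ₗ LinearMap.single ℝ (fun _ => ℂ) s
    have hentry (s s' : QBasis n A.work) :
        (fun x => ψ s (A.stateAfter x t s')) ∈ cubePoly (Fin n) t := ih (ψ s ∘ₗ LinearMap.proj s')
    have hφ : (fun x => φ (A.stateAfter x (t + 1))) =
        ∑ s, fun x => ψ s (A.stateAfter x t (queryBasis x s)) := by
      ext x
      calc φ (A.stateAfter x (t + 1))
          = φ (U.mulVec (∑ s, Pi.single s (A.stateAfter x t (queryBasis x s)))) := by
            rw [Finset.univ_sum_single fun s => A.stateAfter x t (queryBasis x s)]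
            simp only [← oracle_mulVec_apply]
            rfl
        _ = _ := by
          rw [Matrix.mulVec_sum, map_sum, Finset.sum_apply]
          rfl
    rw [hφ]
    refine Submodule.sum_mem _ fun ⟨a, b, i, u, z⟩ _ => ?_
    simp only [apply_queryBasis, map_add, map_smul, map_sub]
    rw [Nat.add_comm]
    exact Submodule.add_mem _ (cubePoly_mono (Nat.le_add_left t 1) (hentry _ _))
      (mul_mem_cubePoly_add (bitVal_bitAt_mem_cubePoly_one _)
        (Submodule.sub_mem _ (hentry _ _) (hentry _ _)))

/-- The unnormalized state of the remaining qubits after the first two qubits of the final state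
have been measured as `1` (postselection succeeds) and `b`. -/
noncomputable def postAmp (A : PostselAlg n) (x : Fin n → Bool) (b : Bool) :
    (Fin (Nat.clog 2 n) → Bool) × Bool × (Fin A.work → Bool) → ℂ :=
  fun r => A.finalState x (true, b, r)

theorem linear_postAmp_mem_cubePoly (A : PostselAlg n) (b : Bool)
    (θ : ((Fin (Nat.clog 2 n) → Bool) × Bool × (Fin A.work → Bool) → ℂ) →ₗ[ℝ] ℝ) :
    (fun x => θ (A.postAmp x b)) ∈ cubePoly (Fin n) A.queries :=
  A.linear_stateAfter_mem_cubePoly A.queries (θ ∘ₗ LinearMap.funLeft ℝ ℂ fun r => (true, b, r))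

theorem jointProb_eq_sum_postAmp (A : PostselAlg n) (x : Fin n → Bool) (b : Bool) :
    A.jointProb x b = ∑ r, ‖A.postAmp x b r‖ ^ 2 := by
  cases b <;> simp [jointProb, postAmp, Fintype.sum_prod_type]

theorem jointProb_nonneg (A : PostselAlg n) (x : Fin n → Bool) (b : Bool) : 0 ≤ A.jointProb x b :=
  A.jointProb_eq_sum_postAmp x b ▸ Finset.sum_nonneg fun _ _ => sq_nonneg _

theorem jointProb_eq_zero_iff (A : PostselAlg n) (x : Fin n → Bool) (b : Bool) :
    A.jointProb x b = 0 ↔ A.postAmp x b = 0 := by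
  rw [jointProb_eq_sum_postAmp, Finset.sum_eq_zero_iff_of_nonneg fun _ _ => sq_nonneg _]
  simp [funext_iff]

theorem postProb_eq_add (A : PostselAlg n) (x : Fin n → Bool) (b : Bool) :
    A.postProb x = A.jointProb x b + A.jointProb x (!b) := by
  rw [postProb, jointProb, jointProb, ← Finset.sum_add_distrib]
  refine Finset.sum_congr rfl ?_
  rintro ⟨a, c, r⟩ -
  cases a <;> cases b <;> cases c <;> simp

theorem computes_zero_iff (A : PostselAlg n) (f : (Fin n → Bool) → Bool) :
    A.Computes 0 f ↔ ∀ x, A.postAmp x (f x) ≠ 0 ∧ A.postAmp x (!f x) = 0 := by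
  refine forall_congr' fun x => ?_
  have hright := A.jointProb_nonneg x (f x)
  have hwrong := A.jointProb_nonneg x (!f x)
  rw [ne_eq, ← jointProb_eq_zero_iff, ← jointProb_eq_zero_iff, A.postProb_eq_add x (f x), sub_zero]
  constructor
  · rintro ⟨hpos, hle⟩
    rw [one_le_div hpos] at hle
    constructor <;> linarith
  · rintro ⟨hne, hzero⟩
    rw [hzero, add_zero, div_self hne]
    exact ⟨hright.lt_of_ne' hne, le_rfl⟩

theorem Computes.hasRationalDegreeLE {A : PostselAlg n} {f : (Fin n → Bool) → Bool}
    (hA : A.Computes 0 f) : HasRationalDegreeLE f A.queries := by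
  rw [computes_zero_iff] at hA
  have hsum (x : Fin n → Bool) : A.postAmp x true + A.postAmp x false = A.postAmp x (f x) := by
    cases hfx : f x <;> simpa [hfx] using (hA x).2
  have htrue (x : Fin n → Bool) : A.postAmp x true = bitVal (f x) • A.postAmp x (f x) := by
    cases hfx : f x
    · simpa [hfx, bitVal] using (hA x).2
    · simp [bitVal]
  obtain ⟨θ, hθ⟩ := Module.exists_dual_forall_apply_ne_zero (K := ℝ)
    (fun x => A.postAmp x true + A.postAmp x false) fun x => hsum x ▸ (hA x).1
  refine ⟨fun x => θ (A.postAmp x true), A.linear_postAmp_mem_cubePoly true θ,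
    fun x => θ (A.postAmp x true + A.postAmp x false), ?_, fun x => ⟨hθ x, ?_⟩⟩
  · simp only [map_add]
    exact Submodule.add_mem _ (A.linear_postAmp_mem_cubePoly true θ)
      (A.linear_postAmp_mem_cubePoly false θ)
  · simp only [hsum]
    rw [htrue, map_smul, smul_eq_mul]

end PostselAlg

section Construction

variable {n w d : ℕ} {L : Type*}

/-- The contents of the index register for a query at `o`: the binary digits of `i` for `some i`,
and arbitrarily the zero address for `none`. -/
def queryAddress (o : Option (Fin n)) : Fin (Nat.clog 2 n) → Bool :=
  fun j => o.elim false fun i => (i : ℕ).testBit j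

theorem ofBits_queryAddress_some (i : Fin n) : Nat.ofBits (queryAddress (some i)) = i := by
  have hlt : (i : ℕ) < 2 ^ Nat.clog 2 n := i.isLt.trans_le (Nat.le_pow_clog one_lt_two n)
  exact (Nat.ofBits_testBit (i : ℕ) _).trans (Nat.mod_eq_of_lt hlt)

/-- The amplitudes of the target qubit of a query at `o`: those of `|-⟩` for `some i`, and those of
`|+⟩`, which no query changes, for `none`. -/
noncomputable def targetAmp (o : Option (Fin n)) (t : Bool) : ℂ :=
  if o.isSome && t then -((√2)⁻¹ : ℝ) else ((√2)⁻¹ : ℝ)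

theorem targetAmp_xor_bitAt (x : Fin n → Bool) (o : Option (Fin n)) (t : Bool) :
    targetAmp o (xor t (bitAt x (Nat.ofBits (queryAddress o)))) =
      (queryPhase o x : ℂ) * targetAmp o t := by
  cases o with
  | none => simp [targetAmp, queryPhase]
  | some i =>
    rw [ofBits_queryAddress_some]
    cases t <;> cases hx : x i <;>
      norm_num [targetAmp, queryPhase, cubeCoord, bitVal, bitAt, hx]

theorem sum_norm_targetAmp_sq (o : Option (Fin n)) : ∑ t, ‖targetAmp o t‖ ^ 2 = 1 := by
  have hnorm (t : Bool) : ‖targetAmp o t‖ ^ 2 = 2⁻¹ := by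
    unfold targetAmp
    split_ifs <;> simp
  norm_num [hnorm]

/-- The state querying `o`, with output qubit `b` and work qubits `z`. -/
noncomputable def queryVec (o : Option (Fin n)) (b : Bool) (z : Fin w → Bool) :
    EuclideanSpace ℂ (QBasis n w) :=
  ∑ t, targetAmp o t • EuclideanSpace.single (false, b, queryAddress o, t, z) 1

theorem oracle_mulVec_queryVec (x : Fin n → Bool) (o : Option (Fin n)) (b : Bool)
    (z : Fin w → Bool) :
    (oracle w x).mulVec (queryVec o b z) = (queryPhase o x : ℂ) • ⇑(queryVec o b z) := by
  have happly (a b' : Bool) (i : Fin (Nat.clog 2 n) → Bool) (t : Bool) (z' : Fin w → Bool) :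
      queryVec o b z (a, b', i, t, z') =
        if a = false ∧ b' = b ∧ i = queryAddress o ∧ z' = z then targetAmp o t else 0 := by
    cases t <;> simp [queryVec]
  ext ⟨a, b', i, t, z'⟩
  rw [oracle_mulVec_apply, Pi.smul_apply, queryBasis, happly, happly]
  split_ifs with hs
  · rw [hs.2.2.1, targetAmp_xor_bitAt, smul_eq_mul]
  · rw [smul_zero]

theorem orthonormal_queryVec (o : L → Option (Fin n)) (enc : L ↪ (Fin w → Bool)) :
    Orthonormal ℂ fun i : L × Bool => queryVec (o i.1) i.2 (enc i.1) := by
  have hbasis : Orthonormal ℂ fun i : (L × Bool) × Bool => EuclideanSpace.single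
      ((false, i.1.2, queryAddress (o i.1.1), i.2, enc i.1.1) : QBasis n w) (1 : ℂ) := by
    refine EuclideanSpace.orthonormal_single.comp _ ?_
    rintro ⟨⟨l, b⟩, t⟩ ⟨⟨l', b'⟩, t'⟩ h
    simp only [Prod.mk.injEq, enc.injective.eq_iff] at h ⊢
    tauto
  exact orthonormal_sum_smul hbasis fun i => sum_norm_targetAmp_sq (o i.1)

/-- The common component `r • |1, b, 0⟩` makes the amplitudes of all indices with the same output
bit interfere; postselection discards the rest, which only serves to restore orthogonality. -/
theorem exists_orthonormal_postselected_eq [Finite L] [Nonempty L] (enc : L ↪ (Fin w → Bool)) :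
    ∃ v : L × Bool → EuclideanSpace ℂ (QBasis n w), Orthonormal ℂ v ∧ ∃ r : ℂ, r ≠ 0 ∧
      ∀ i b s, v i (true, b, s) = if b = i.2 ∧ s = (zeroBasis n w).2.2 then r else 0 := by
  have := Fintype.ofFinite L
  have hcard : (0 : ℝ) < Fintype.card L := by exact_mod_cast Fintype.card_pos
  let r : ℂ := ((√(Fintype.card L))⁻¹ : ℝ)
  have hr : (Fintype.card L : ℝ) * ‖r‖ ^ 2 = 1 := by
    simp [r, Real.sq_sqrt hcard.le, hcard.ne']
  have hfailed : Orthonormal ℂ fun i : L × Bool => EuclideanSpace.single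
      ((false, i.2, fun _ => false, false, enc i.1) : QBasis n w) (1 : ℂ) := by
    refine EuclideanSpace.orthonormal_single.comp _ ?_
    rintro ⟨l, b⟩ ⟨l', b'⟩ h
    simp only [Prod.mk.injEq, enc.injective.eq_iff] at h ⊢
    tauto
  have hpost : Orthonormal ℂ fun b : Bool => EuclideanSpace.single
      ((true, b, (zeroBasis n w).2.2) : QBasis n w) (1 : ℂ) :=
    EuclideanSpace.orthonormal_single.comp _ fun b b' h => by simpa using h
  refine ⟨_, orthonormal_add_smul_sub_smul_sum hfailed hpost (fun i b => ?_) hr, r, ?_, ?_⟩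
  · simp [EuclideanSpace.inner_single_left]
  · simp [r, hcard.ne']
  · simp

/-- The unitaries carry each orthonormal family to the next one; in between, every query multiplies
the coefficients by its eigenvalues. -/
theorem exists_postselAlg_finalState_eq {ι : Type*} [Fintype ι]
    {v : Fin (d + 1) → ι → EuclideanSpace ℂ (QBasis n w)} (hv : ∀ t, Orthonormal ℂ (v t))
    {φ : Fin d → ι → (Fin n → Bool) → ℂ}
    (hφ : ∀ t i x, (oracle w x).mulVec (v t.castSucc i) = φ t i x • ⇑(v t.castSucc i))
    {a : ι → ℂ} (ha : a ≠ 0) :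
    ∃ U : ℕ → Matrix.unitaryGroup (QBasis n w) ℂ, ∃ c : ℂ, c ≠ 0 ∧
      ∀ x, (⟨w, d, U⟩ : PostselAlg n).finalState x =
        c • ∑ i, (a i * ∏ k, φ k i x) • ⇑(v (Fin.last d) i) := by
  have hstart : ∑ i, a i • v 0 i ≠ 0 := fun h =>
    ha (funext (Fintype.linearIndependent_iff.mp (hv 0).linearIndependent a h))
  obtain ⟨U₀, c, hc, hU₀⟩ := exists_unitaryGroup_mulVec_single_eq_smul hstart (zeroBasis n w)
  choose G hG using fun t : Fin d =>
    exists_unitaryGroup_mulVec_eq_of_orthonormal (hv t.castSucc) (hv t.succ)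
  let A : PostselAlg n := ⟨w, d, fun
    | 0 => U₀
    | t + 1 => if h : t < d then G ⟨t, h⟩ else 1⟩
  have hstate (x : Fin n → Bool) (t : Fin (d + 1)) : A.stateAfter x t =
      c • ∑ i, (a i * Fin.partialProd (fun k => φ k i x) t) • ⇑(v t i) := by
    induction t using Fin.induction with
    | zero => simpa [PostselAlg.stateAfter, A] using hU₀
    | succ t ih =>
      have hU : A.U (t + 1) = G t := by simp [A]
      calc A.stateAfter x t.succ
          = (G t : Matrix _ _ ℂ).mulVec ((oracle w x).mulVec (A.stateAfter x t.castSucc)) := by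
            rw [← hU]
            rfl
        _ = _ := by
          simp only [ih, Matrix.mulVec_smul, Matrix.mulVec_sum, hφ, hG, Fin.partialProd_succ,
            smul_smul, mul_assoc]
  refine ⟨A.U, c, hc, fun x => (hstate x (Fin.last d)).trans ?_⟩
  simp [Fin.partialProd, List.take_of_length_le, List.prod_ofFn]

theorem exists_postselAlg_postAmp_eq {F : Bool → (Fin n → Bool) → ℝ}
    (hF : ∀ b, F b ∈ cubePoly (Fin n) d) (hF0 : F ≠ 0) :
    ∃ A : PostselAlg n, A.queries = d ∧ ∃ c : ℂ, c ≠ 0 ∧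
      ∀ x b, A.postAmp x b = Pi.single (zeroBasis n A.work).2.2 (c * F b x) := by
  simp only [cubePoly_eq_span_prod_queryPhase, Submodule.mem_span_range_iff_exists_fun] at hF
  choose a ha using hF
  have ha0 : (fun i : (Fin d → Option (Fin n)) × Bool => (a i.2 i.1 : ℂ)) ≠ 0 := by
    refine fun h => hF0 (funext fun b => ?_)
    have hab (l : Fin d → Option (Fin n)) : a b l = 0 := by simpa using congrFun h (l, b)
    simp [← ha b, hab]
  obtain ⟨w, ⟨enc⟩⟩ : ∃ w, Nonempty ((Fin d → Option (Fin n)) ↪ (Fin w → Bool)) :=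
    ⟨_, Function.Embedding.nonempty_of_card_le (by simpa using Nat.lt_two_pow_self.le)⟩
  obtain ⟨out, hout, r, hr, hout_apply⟩ := exists_orthonormal_postselected_eq (n := n) enc
  let v := Fin.snoc (α := fun _ => (Fin d → Option (Fin n)) × Bool → EuclideanSpace ℂ (QBasis n w))
    (fun t i => queryVec (i.1 t) i.2 (enc i.1)) out
  have hv (t : Fin (d + 1)) : Orthonormal ℂ (v t) := by
    cases t using Fin.lastCases with
    | last => simpa [v] using hout
    | cast t => simpa [v] using orthonormal_queryVec (fun l : Fin d → Option (Fin n) => l t) enc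
  obtain ⟨U, c, hc, hfinal⟩ := exists_postselAlg_finalState_eq hv
    (φ := fun t i x => (queryPhase (i.1 t) x : ℂ))
    (fun t i x => by simpa [v] using oracle_mulVec_queryVec x (i.1 t) i.2 (enc i.1)) ha0
  refine ⟨⟨_, d, U⟩, rfl, c * r, mul_ne_zero hc hr, fun x b => ?_⟩
  ext s
  rw [PostselAlg.postAmp, hfinal]
  by_cases hs : s = (zeroBasis n w).2.2
  · calc _ = c * ∑ l, (a b l * ∏ k, (queryPhase (l k) x : ℂ)) * r := by
          cases b <;> simp [v, hout_apply, hs, Fintype.sum_prod_type]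
      _ = c * r * F b x := by
          rw [← Finset.sum_mul, ← ha b]
          simp only [Finset.sum_apply, Pi.smul_apply, Finset.prod_apply, smul_eq_mul]
          push_cast
          ring
      _ = _ := by simp [hs]
  · simp [v, hout_apply, hs]

theorem mem_postQueryCounts_of_hasRationalDegreeLE {f : (Fin n → Bool) → Bool}
    (hf : HasRationalDegreeLE f d) : d ∈ postQueryCounts 0 f := by
  obtain ⟨P, hP, Q, hQ, hPQ⟩ := hf
  let F (b : Bool) : (Fin n → Bool) → ℝ := if b then P else Q - P
  have hF (b : Bool) : F b ∈ cubePoly (Fin n) d := by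
    cases b
    · exact Submodule.sub_mem _ hQ hP
    · exact hP
  have hright (x : Fin n → Bool) : F (f x) x = Q x := by
    cases hfx : f x <;> simp [F, (hPQ x).2, hfx, bitVal]
  have hwrong (x : Fin n → Bool) : F (!f x) x = 0 := by
    cases hfx : f x <;> simp [F, (hPQ x).2, hfx, bitVal]
  have hF0 : F ≠ 0 := fun h => (hPQ fun _ => false).1 (by rw [← hright, h]; rfl)
  obtain ⟨A, hA, c, hc, hpost⟩ := exists_postselAlg_postAmp_eq hF hF0
  refine ⟨A, (A.computes_zero_iff f).mpr fun x => ?_, hA.symm⟩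
  simp [hpost, hright, hwrong, hc, (hPQ x).1]

end Construction

theorem hasRationalDegreeLE_iff_mem_postQueryCounts {n d : ℕ} {f : (Fin n → Bool) → Bool} :
    HasRationalDegreeLE f d ↔ d ∈ postQueryCounts 0 f := by
  refine ⟨mem_postQueryCounts_of_hasRationalDegreeLE, ?_⟩
  rintro ⟨A, hA, rfl⟩
  exact hA.hasRationalDegreeLE

theorem mainTheorem10 (n : ℕ) (hn : 0 < n) (f : (Fin n → Bool) → Bool) :
    (rationalRepDegrees f).Nonempty ∧ (postQueryCounts 0 f).Nonempty ∧
      rdeg f = PostQ 0 f := by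
  have hcounts : postQueryCounts 0 f = upperClosure (rationalRepDegrees f) := by
    ext d
    exact hasRationalDegreeLE_iff_mem_postQueryCounts.symm.trans
      hasRationalDegreeLE_iff_mem_upperClosure
  have hpost : (postQueryCounts 0 f).Nonempty :=
    ⟨_, hasRationalDegreeLE_iff_mem_postQueryCounts.mp (hasRationalDegreeLE_card f)⟩
  have hdeg : (rationalRepDegrees f).Nonempty := by
    obtain ⟨d, hd, -⟩ := hasRationalDegreeLE_iff_mem_upperClosure.mp (hasRationalDegreeLE_card f)
    exact ⟨d, hd⟩
  have hglb : IsGLB (rationalRepDegrees f) (PostQ 0 f) := by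
    rw [IsGLB, ← lowerBounds_upperClosure, ← hcounts]
    exact isGLB_csInf hpost
  exact ⟨hdeg, hpost, (isGLB_csInf hdeg).unique hglb⟩
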